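/- Let $\mathbb{X}$ be a separable reflexive real Banach space with strictly convex dual $\mathbb{X}^*$, let $\mathbb{U}$ be a separable real Hilbert space (identified with its dual), let $\mathcal{T}(t)$, $t\ge 0$, be a $C_0$-semigroup on $\mathbb{X}$ with generator $\mathrm{A}$ and $\|\mathcal{T}(t)\|\le M$ for all $t\ge0$, and let $\mathrm{B}:\mathbb{U}\to\mathbb{X}$ be a bounded linear operator. Fix $\frac12<\alpha<1$, $T>0$, $\lambda>0$ and $\zeta,x_T\in\mathbb{X}$. Put, for $\xi>0$, $$\phi_\alpha(\xi)=\frac1\pi\sum_{n=1}^\infty(-1)^{n-1}\xi^{-n\alpha-1}\frac{\Gamma(n\alpha+1)}{n!}\sin(n\pi\alpha),\qquad \varphi_\alpha(\xi)=\frac1\alpha\,\xi^{-1-\frac1\alpha}\phi_\alpha(\xi^{-\frac1\alpha}),$$ and, for $t\ge0$, $x\in\mathbb{X}$, $$\mathcal{T}_\alpha(t)x=\int_0^\infty\varphi_\alpha(\xi)\mathcal{T}(t^\alpha\xi)x\,d\xi,\qquad \widehat{\mathcal{T}}_\alpha(t)x=\alpha\int_0^\infty\xi\varphi_\alpha(\xi)\mathcal{T}(t^\alpha\xi)x\,d\xi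 .$$ Let $\mathcal{J}:\mathbb{X}\to\mathbb{X}^*$ be the (single-valued) duality map, $\langle x,\mathcal{J}[x]\rangle=\|x\|^2=\|\mathcal{J}[x]\|^2$, and let $$\Phi_0^T=\int_0^T(T-t)^{2(\alpha-1)}\widehat{\mathcal{T}}_\alpha(T-t)\mathrm{B}\mathrm{B}^*\widehat{\mathcal{T}}_\alpha(T-t)^*\,dt:\mathbb{X}^*\to\mathbb{X}.$$ Consider the linear regulator problem of minimizing $$\mathcal{G}(x,u)=\|x(T)-x_T\|_{\mathbb{X}}^2+\lambda\int_0^T\|u(t)\|_{\mathbb{U}}^2\,dt$$ over all pairs $(x,u)$ with $u\in L^2([0,T];\mathbb{U})$ and $x$ the mild solution of ${}^C\!D^\alpha_{0,t}x=\mathrm{A}x+\mathrm{B}u$, $x(0)=\zeta$, that is, $$x(t)=\mathcal{T}_\alpha(t)\zeta+\int_0^t(t-s)^{\alpha-1}\widehat{\mathcal{T}}_\alpha(t-s)\mathrm{B}u(s)\,ds,\qquad t\in[0,T].$$ Let $(x,u)$ be an optimal pair of this problem. Then the map $\lambda\mathrm{I}+\Phi_0^T\mathcal{J}:\mathbb{X}\to\mathbb{X}$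 is bijective, so that the resolvent $\mathcal{R}(\lambda,\Phi_0^T)=(\lambda\mathrm{I}+\Phi_0^T\mathcal{J})^{-1}$ is defined, and the optimal control is given by $$u(t)=(T-t)^{\alpha-1}\,\mathrm{B}^*\,\widehat{\mathcal{T}}_\alpha(T-t)^*\,\mathcal{J}\big[\mathcal{R}(\lambda,\Phi_0^T)\,(x_T-\mathcal{T}_\alpha(T)\zeta)\big],\qquad t\in[0,T),$$ where the right-hand side is continuous on $[0,T)$ and the equality holds for almost every $t\in[0,T)$ (hence for every $t\in[0,T)$ if $u$ denotes the continuous representative of the optimal control). -/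

import Mathlib

noncomputable section

open MeasureTheory Set Filter Topology
open scoped NNReal

namespace FracRegulator

/-- One-sided stable probability density of order `q`,
`φ_q(ξ) = π⁻¹ ∑_{n ≥ 1} (-1)^(n-1) ξ^(-nq-1) Γ(nq+1)/n! sin(nπq)`, for `ξ > 0`, `0 < q < 1`
(the summation index is shifted by one). -/
def stableDensity (q ξ : ℝ) : ℝ :=
  1 / Real.pi * ∑' n : ℕ, (-1) ^ n * ξ ^ (-((n + 1 : ℕ) : ℝ) * q - 1) *
    (Real.Gamma (((n + 1 : ℕ) : ℝ) * q + 1) / ((n + 1).factorial : ℝ)) *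
      Real.sin (((n + 1 : ℕ) : ℝ) * Real.pi * q)

/-- The probability density `ϕ_q(ξ) = q⁻¹ ξ^(-1-1/q) φ_q(ξ^(-1/q))` on `(0, ∞)`, where `φ_q` is the
stable density above. -/
def subordDensity (q ξ : ℝ) : ℝ :=
  1 / q * ξ ^ (-1 - 1 / q) * stableDensity q (ξ ^ (-(1 / q)))

/-! Integrability of `ξ ↦ ξ * subordDensity q ξ` on `(0, ∞)`, needed to see that the operator
`hatOp` below is bounded. -/

theorem gammaRay_deriv {s : ℝ} (hs : 0 < s) {w : ℂ} (hw : 0 < w.re) :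
    DifferentiableAt ℂ
      (fun w : ℂ => ∫ t in Ioi (0 : ℝ), ((t ^ (s - 1) : ℝ) : ℂ) * Complex.exp (-(w * t))) w := by
  have hc : 0 < w.re / 2 := by positivity
  have hmeas : ∀ z : ℂ, AEStronglyMeasurable
      (fun t : ℝ => ((t ^ (s - 1) : ℝ) : ℂ) * Complex.exp (-(z * t))) (volume.restrict (Ioi 0)) := by
    intro z
    apply Measurable.aestronglyMeasurable
    fun_prop
  have hint : ∀ p : ℝ, -1 < p → ∀ c : ℝ, 0 < c →
      IntegrableOn (fun t : ℝ => t ^ p * Real.exp (-c * t)) (Ioi 0) := by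
    intro p hp c hc
    simpa using integrableOn_rpow_mul_exp_neg_mul_rpow (s := p) (p := 1) (b := c) hp one_pos hc
  refine (hasDerivAt_integral_of_dominated_loc_of_deriv_le (𝕜 := ℂ)
    (F := fun (w : ℂ) (t : ℝ) => ((t ^ (s - 1) : ℝ) : ℂ) * Complex.exp (-(w * t)))
    (F' := fun (w : ℂ) (t : ℝ) => ((t ^ (s - 1) : ℝ) : ℂ) * (Complex.exp (-(w * t)) * (-t)))
    (bound := fun t => t ^ s * Real.exp (-(w.re / 2) * t))
    (s := {z : ℂ | w.re / 2 < z.re}) (x₀ := w) ?_ ?_ ?_ ?_ ?_ ?_ ?_).2.differentiableAt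
  · exact (isOpen_lt continuous_const Complex.continuous_re).mem_nhds (by simp; linarith)
  · exact Eventually.of_forall hmeas
  · refine (hint (s - 1) (by linarith) w.re hw).mono' (hmeas w) ?_
    filter_upwards [ae_restrict_mem measurableSet_Ioi] with t ht
    have ht : 0 < t := ht
    rw [norm_mul, Complex.norm_exp, Complex.norm_real, Real.norm_of_nonneg (by positivity)]
    simp
  · apply Measurable.aestronglyMeasurable
    fun_prop
  · filter_upwards [ae_restrict_mem measurableSet_Ioi] with t ht z hz
    have ht : 0 < t := ht
    have hz : w.re / 2 < z.re := hz
    rw [norm_mul, norm_mul, Complex.norm_exp, Complex.norm_real, norm_neg, Complex.norm_real,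
      Real.norm_of_nonneg (by positivity), Real.norm_of_nonneg ht.le]
    have : t ^ s = t ^ (s - 1) * t := by rw [← Real.rpow_add_one ht.ne']; simp
    rw [this, mul_comm (Real.exp _) t, ← mul_assoc]
    gcongr
    simp
    nlinarith
  · exact hint s (by linarith) _ hc
  · refine Eventually.of_forall fun t z _ => ?_
    have h1 : HasDerivAt (fun z : ℂ => -(z * (t : ℂ))) (-(t : ℂ)) z := by
      simpa using! ((hasDerivAt_id z).mul_const (t : ℂ)).neg
    exact (h1.cexp).const_mul _

theorem gammaRay {s : ℝ} (hs : 0 < s) {w : ℂ} (hw : 0 < w.re) :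
    ∫ t in Ioi (0 : ℝ), ((t ^ (s - 1) : ℝ) : ℂ) * Complex.exp (-(w * t))
      = w ^ (-(s : ℂ)) * (Real.Gamma s : ℂ) := by
  have hopen : IsOpen {z : ℂ | 0 < z.re} := isOpen_lt continuous_const Complex.continuous_re
  have hf : AnalyticOnNhd ℂ
      (fun w : ℂ => ∫ t in Ioi (0 : ℝ), ((t ^ (s - 1) : ℝ) : ℂ) * Complex.exp (-(w * t)))
      {z : ℂ | 0 < z.re} :=
    DifferentiableOn.analyticOnNhd
      (fun z hz => (gammaRay_deriv hs hz).differentiableWithinAt) hopen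
  have hg : AnalyticOnNhd ℂ (fun w : ℂ => w ^ (-(s : ℂ)) * (Real.Gamma s : ℂ))
      {z : ℂ | 0 < z.re} := by
    refine DifferentiableOn.analyticOnNhd (fun z hz => ?_) hopen
    refine DifferentiableAt.differentiableWithinAt ?_
    refine DifferentiableAt.mul_const ?_ _
    exact differentiableAt_id.cpow_const (Or.inl hz)
  refine hf.eqOn_of_preconnected_of_frequently_eq hg
    ((convex_halfSpace_re_gt 0).isPreconnected) (z₀ := 1) (by simp) ?_ hw
  have hreal : ∀ r : ℝ, 0 < r →
      ∫ t in Ioi (0 : ℝ), ((t ^ (s - 1) : ℝ) : ℂ) * Complex.exp (-((r : ℂ) * t))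
      = (r : ℂ) ^ (-(s : ℂ)) * (Real.Gamma s : ℂ) := by
    intro r hr
    have h := Real.integral_rpow_mul_exp_neg_mul_Ioi hs hr
    have h2 : (1 / r) ^ s = r ^ (-s) := by
      rw [Real.rpow_neg hr.le, one_div, Real.inv_rpow hr.le]
    rw [h2] at h
    have h3 := congrArg (fun x : ℝ => (x : ℂ)) h
    simp only [← integral_complex_ofReal] at h3
    rw [Complex.ofReal_mul, Complex.ofReal_cpow hr.le] at h3
    push_cast at h3 ⊢
    exact h3
  have hseq : Tendsto (fun n : ℕ => ((1 + 1 / ((n : ℝ) + 1) : ℝ) : ℂ)) atTop (𝓝[≠] 1) := by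
    refine tendsto_nhdsWithin_iff.2 ⟨?_, Eventually.of_forall fun n => ?_⟩
    · have h1 : Tendsto (fun n : ℕ => (1 + 1 / ((n : ℝ) + 1) : ℝ)) atTop (𝓝 (1 + 0)) :=
        tendsto_const_nhds.add tendsto_one_div_add_atTop_nhds_zero_nat
      have h2 := (Complex.continuous_ofReal.tendsto (1 + 0 : ℝ)).comp h1
      simpa only [add_zero, Complex.ofReal_one] using! h2
    · have h3 : (0 : ℝ) < 1 / ((n : ℝ) + 1) := by positivity
      have : (1 + 1 / ((n : ℝ) + 1) : ℝ) ≠ 1 := by linarith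
      simp only [mem_compl_iff, mem_singleton_iff]
      exact_mod_cast this
  exact hseq.frequently (Frequently.of_forall fun n => hreal _ (by positivity))

theorem integrableOn_exp_rpow_sub {q c : ℝ} (hq0 : 0 < q) (hq : q < 1) (hc : 0 < c) (ξ : ℝ) :
    IntegrableOn (fun t : ℝ => Real.exp (ξ * t ^ q - c * t)) (Ioi 0) := by
  refine integrable_of_isBigO_exp_neg (b := c / 2) (by positivity) ?_ ?_
  · refine Continuous.continuousOn ?_
    have : Continuous fun t : ℝ => t ^ q := Real.continuous_rpow_const hq0.le
    fun_prop
  · have h1 : Tendsto (fun t : ℝ => ξ * t ^ (-(1 - q))) atTop (𝓝 (ξ * 0)) :=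
      (tendsto_rpow_neg_atTop (by linarith)).const_mul ξ
    rw [mul_zero] at h1
    refine Asymptotics.IsBigO.of_bound 1 ?_
    filter_upwards [h1.eventually_lt_const (show 0 < c / 2 by positivity), eventually_gt_atTop 0]
      with t ht ht0
    have h2 : t ^ q = t ^ (-(1 - q)) * t := by
      rw [← Real.rpow_add_one ht0.ne']; congr 1; ring
    rw [Real.norm_of_nonneg (Real.exp_pos _).le, Real.norm_of_nonneg (Real.exp_pos _).le, one_mul]
    apply Real.exp_le_exp.2
    rw [h2]
    nlinarith

/-- Auxiliary kernel, used only for the integrability of `ξ * subordDensity q ξ`. -/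
def rayKernel (q δ β ξ t : ℝ) : ℂ :=
  Complex.exp (-(ξ * (t ^ q : ℝ) * Complex.exp (β * Complex.I)))
    * Complex.exp (-(Complex.exp (-(δ * Complex.I)) * t))

theorem norm_rayKernel (q δ β ξ t : ℝ) :
    ‖rayKernel q δ β ξ t‖
      = Real.exp (-(Real.cos β * t ^ q) * ξ) * Real.exp (-Real.cos δ * t) := by
  unfold rayKernel
  rw [norm_mul, Complex.norm_exp, Complex.norm_exp]
  have h1 : (Complex.exp (β * Complex.I)).re = Real.cos β := Complex.exp_ofReal_mul_I_re β
  have h2 : (Complex.exp (-(δ * Complex.I))).re = Real.cos δ := by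
    rw [← neg_mul, ← Complex.ofReal_neg, Complex.exp_ofReal_mul_I_re, Real.cos_neg]
  rw [← Complex.ofReal_mul, Complex.neg_re, Complex.re_ofReal_mul, h1, Complex.neg_re,
    Complex.re_mul_ofReal, h2]
  congr 1 <;> congr 1 <;> ring

theorem integrable_rayKernel {q δ β : ℝ} (hq : q < 1) (hδ : 0 < Real.cos δ)
    (hβ : 0 < Real.cos β) :
    Integrable (fun p : ℝ × ℝ => rayKernel q δ β p.1 p.2)
      ((volume.restrict (Ioi 0)).prod (volume.restrict (Ioi 0))) := by
  have hm : Measurable (fun p : ℝ × ℝ => rayKernel q δ β p.1 p.2) := by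
    unfold rayKernel
    fun_prop
  rw [integrable_prod_iff' hm.aestronglyMeasurable]
  constructor
  · filter_upwards [ae_restrict_mem measurableSet_Ioi] with t ht
    have ht : 0 < t := ht
    refine Integrable.mono' (g := fun ξ => ‖rayKernel q δ β ξ t‖) ?_
      (hm.comp (by fun_prop : Measurable fun ξ : ℝ => (ξ, t))).aestronglyMeasurable
      (Eventually.of_forall fun ξ => le_rfl)
    simp only [norm_rayKernel]
    refine Integrable.mul_const (integrableOn_exp_mul_Ioi ?_ 0) _
    have : 0 < t ^ q := by positivity
    nlinarith
  · have h1 := integrableOn_rpow_mul_exp_neg_mul_rpow (s := -q) (p := 1) (b := Real.cos δ)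
      (by linarith) one_pos hδ
    refine Integrable.congr (h1.const_mul (Real.cos β)⁻¹) ?_
    filter_upwards [ae_restrict_mem measurableSet_Ioi] with t ht
    have ht : 0 < t := ht
    have h2 : 0 < t ^ q := by positivity
    simp only [norm_rayKernel]
    rw [integral_mul_const, integral_exp_mul_Ioi (by nlinarith), Real.rpow_neg ht.le]
    simp
    field_simp

theorem mul_subordDensity {q δ : ℝ} (hq0 : 0 < q) (hq : q < 1) (hδ : 0 < Real.cos δ)
    (hδ1 : -Real.pi < -δ) (hδ2 : -δ ≤ Real.pi)
    {ξ : ℝ} (hξ : 0 < ξ) :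
    ξ * subordDensity q ξ = -(1 / (Real.pi * q)) *
      (Complex.exp (-(δ * Complex.I)) *
        ∫ t in Ioi (0 : ℝ), rayKernel q δ (q * (Real.pi - δ)) ξ t).im := by
  set β := q * (Real.pi - δ) with hβ
  set w := Complex.exp (-(δ * Complex.I)) with hw
  have hwre : w.re = Real.cos δ := by
    rw [hw, ← neg_mul, ← Complex.ofReal_neg, Complex.exp_ofReal_mul_I_re, Real.cos_neg]
  have hwpow : ∀ s : ℝ, w ^ (-(s : ℂ)) = Complex.exp (s * δ * Complex.I) := by
    intro s
    rw [hw, Complex.cpow_def_of_ne_zero (Complex.exp_ne_zero _),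
      Complex.log_exp (by simpa using hδ1) (by simpa using hδ2)]
    congr 1; ring
  have hsum := hasSum_integral_of_dominated_convergence (μ := volume.restrict (Ioi (0 : ℝ)))
    (F := fun (n : ℕ) (t : ℝ) => (-(ξ * (t ^ q : ℝ) * Complex.exp (β * Complex.I))) ^ n
        / (n.factorial : ℂ) * Complex.exp (-(w * t)))
    (f := fun t => rayKernel q δ β ξ t)
    (fun n t => (ξ * t ^ q) ^ n / n.factorial * Real.exp (-Real.cos δ * t))
    (fun n => by
      apply Measurable.aestronglyMeasurable
      fun_prop)
    (fun n => by
      filter_upwards [ae_restrict_mem measurableSet_Ioi] with t ht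
      have ht : 0 < t := ht
      rw [norm_mul, norm_div, norm_pow, norm_neg, norm_mul, norm_mul, Complex.norm_exp_ofReal_mul_I,
        Complex.norm_real, Complex.norm_real, Real.norm_of_nonneg hξ.le,
        Real.norm_of_nonneg (by positivity), Complex.norm_natCast, Complex.norm_exp, mul_one,
        Complex.neg_re, Complex.re_mul_ofReal, hwre, neg_mul])
    (by
      refine Eventually.of_forall fun t => Summable.mul_right _ ?_
      exact Real.summable_pow_div_factorial _)
    (by
      refine (integrableOn_exp_rpow_sub hq0 hq hδ ξ).congr ?_
      refine Eventually.of_forall fun t => ?_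
      simp only
      rw [tsum_mul_right, (NormedSpace.expSeries_div_hasSum_exp (ξ * t ^ q)).tsum_eq, ← Real.exp_eq_exp_ℝ,
        ← Real.exp_add]
      congr 1; ring)
    (by
      refine Eventually.of_forall fun t => ?_
      refine HasSum.mul_right _ ?_
      rw [Complex.exp_eq_exp_ℂ]
      exact NormedSpace.expSeries_div_hasSum_exp _)
  have hterm : ∀ n : ℕ, (w * ∫ t in Ioi (0 : ℝ),
      (-(ξ * (t ^ q : ℝ) * Complex.exp (β * Complex.I))) ^ n
        / (n.factorial : ℂ) * Complex.exp (-(w * t))).im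
      = (-ξ) ^ n / n.factorial * Real.Gamma (n * q + 1) * Real.sin (n * Real.pi * q) := by
    intro n
    have hs : 0 < (n : ℝ) * q + 1 := by positivity
    have h1 : ∀ t ∈ Ioi (0 : ℝ), (-(ξ * (t ^ q : ℝ) * Complex.exp (β * Complex.I))) ^ n
        / (n.factorial : ℂ) * Complex.exp (-(w * t))
        = ((-ξ : ℂ) ^ n / n.factorial * Complex.exp (n * β * Complex.I)) *
          (((t ^ ((n : ℝ) * q + 1 - 1) : ℝ) : ℂ) * Complex.exp (-(w * t))) := by
      intro t ht
      have ht : 0 < t := ht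
      have e1 : t ^ ((n : ℝ) * q + 1 - 1) = (t ^ q) ^ n := by
        rw [← Real.rpow_natCast, ← Real.rpow_mul ht.le]; congr 1; ring
      have e2 : Complex.exp (n * β * Complex.I) = Complex.exp (β * Complex.I) ^ n := by
        rw [← Complex.exp_nat_mul]; congr 1; ring
      rw [e1, e2, Complex.ofReal_pow, ← neg_mul, ← neg_mul, mul_pow, mul_pow]
      ring
    rw [setIntegral_congr_fun measurableSet_Ioi h1, integral_const_mul,
      gammaRay hs (by rw [hwre]; exact hδ), hwpow]
    have h2 : w * ((-ξ : ℂ) ^ n / n.factorial * Complex.exp (n * β * Complex.I) *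
        (Complex.exp (((n * q + 1 : ℝ) : ℂ) * δ * Complex.I) * (Real.Gamma (n * q + 1) : ℂ)))
        = ((((-ξ) ^ n / n.factorial * Real.Gamma (n * q + 1) : ℝ)) : ℂ) *
          Complex.exp (((n * Real.pi * q : ℝ) : ℂ) * Complex.I) := by
      have e3 : w * Complex.exp (n * β * Complex.I) *
          Complex.exp (((n * q + 1 : ℝ) : ℂ) * δ * Complex.I)
          = Complex.exp (((n * Real.pi * q : ℝ) : ℂ) * Complex.I) := by
        rw [hw, ← Complex.exp_add, ← Complex.exp_add, hβ]
        congr 1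
        push_cast
        ring
      rw [← e3]
      push_cast
      ring
    rw [h2, Complex.im_ofReal_mul, Complex.exp_ofReal_mul_I_im]
  have hsum2 := Complex.hasSum_im (hsum.mul_left w)
  simp only [hterm] at hsum2
  rw [← hasSum_nat_add_iff' 1] at hsum2
  simp only [Finset.range_one, Finset.sum_singleton, Nat.cast_zero, zero_mul, Real.sin_zero,
    mul_zero, sub_zero] at hsum2
  rw [← hsum2.tsum_eq, subordDensity, stableDensity, ← tsum_mul_left, ← tsum_mul_left,
    ← tsum_mul_left, ← tsum_mul_left]
  refine tsum_congr fun n => ?_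
  have e4 : (ξ ^ (-(1 / q))) ^ (-((n + 1 : ℕ) : ℝ) * q - 1) = ξ ^ (n + 1) * ξ ^ (1 / q) := by
    rw [← Real.rpow_mul hξ.le, ← Real.rpow_natCast, ← Real.rpow_add hξ]
    congr 1
    field_simp
    ring
  have e5 : ξ ^ (-1 - 1 / q) = ξ⁻¹ * (ξ ^ (1 / q))⁻¹ := by
    rw [sub_eq_add_neg, Real.rpow_add hξ, Real.rpow_neg hξ.le, Real.rpow_neg hξ.le, Real.rpow_one]
  have e6 : 0 < ξ ^ (1 / q) := by positivity
  rw [e4, e5, neg_pow ξ]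
  field_simp
  ring

theorem integrableOn_mul_subordDensity {q : ℝ} (hq0 : 0 < q) (hq : q < 1) :
    IntegrableOn (fun ξ => ξ * subordDensity q ξ) (Ioi 0) := by
  have hpi := Real.pi_pos
  set δ := Real.pi / 2 - Real.pi * (1 - q) / 4 with hδ
  have hc1 : 0 < Real.cos δ := Real.cos_pos_of_mem_Ioo ⟨by nlinarith, by nlinarith⟩
  have hc2 : 0 < Real.cos (q * (Real.pi - δ)) := by
    have h1 : q * (Real.pi - δ) = Real.pi / 2 - Real.pi / 4 * ((1 - q) * (2 - q)) := by
      rw [hδ]; ring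
    have h2 : 0 < (1 - q) * (2 - q) := by nlinarith
    have h3 : (1 - q) * (2 - q) < 2 := by nlinarith
    refine Real.cos_pos_of_mem_Ioo ⟨by rw [h1]; nlinarith, by rw [h1]; nlinarith⟩
  have h := (integrable_rayKernel hq hc1 hc2).integral_prod_left
  refine Integrable.congr (((h.const_mul (Complex.exp (-(δ * Complex.I)))).im).const_mul
    (-(1 / (Real.pi * q)))) ?_
  filter_upwards [ae_restrict_mem measurableSet_Ioi] with ξ hξ
  rw [mul_subordDensity hq0 hq hc1 (by nlinarith) (by nlinarith) hξ]
  rfl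

/-- A strongly continuous semigroup (`C₀`-semigroup) of bounded linear operators. -/
structure C0Semigroup (X : Type*) [NormedAddCommGroup X] [NormedSpace ℝ X] where
  /-- the operator at time `t ≥ 0` -/
  op : ℝ≥0 → X →L[ℝ] X
  op_zero : op 0 = ContinuousLinearMap.id ℝ X
  op_add : ∀ s t : ℝ≥0, op (s + t) = (op s).comp (op t)
  continuous_orbit : ∀ x : X, Continuous fun t => op t x

/-- The set-valued duality mapping
`J[x] = {f ∈ X* : ⟨x, f⟩ = ‖x‖² = ‖f‖²}`. -/
def dualitySet {X : Type*} [NormedAddCommGroup X] [NormedSpace ℝ X] (x : X) :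
    Set (StrongDual ℝ X) :=
  {f | f x = ‖x‖ ^ 2 ∧ ‖f‖ ^ 2 = ‖x‖ ^ 2}

theorem dualitySet_nonempty {X : Type*} [NormedAddCommGroup X] [NormedSpace ℝ X] (x : X) :
    (dualitySet x).Nonempty := by
  by_cases hx : x = 0
  · exact ⟨0, by simp [dualitySet, hx]⟩
  · obtain ⟨g, hg, hgx⟩ := exists_dual_vector ℝ x (norm_ne_zero_iff.2 hx)
    refine ⟨‖x‖ • g, ?_, ?_⟩
    · simp only [smul_apply, hgx, smul_eq_mul]
      simp [sq]
    · simp [norm_smul, hg]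

/-- The duality map as a single-valued map; `dualitySet_eq_singleton` shows that it is the only
selection of `dualitySet` when the dual space is strictly convex. -/
def dualityMap {X : Type*} [NormedAddCommGroup X] [NormedSpace ℝ X] (x : X) : StrongDual ℝ X :=
  (dualitySet_nonempty x).choose

theorem dualitySet_eq_singleton {X : Type*} [NormedAddCommGroup X] [NormedSpace ℝ X]
    [StrictConvexSpace ℝ (StrongDual ℝ X)] (x : X) : dualitySet x = {dualityMap x} := by
  have huniq : ∀ f ∈ dualitySet x, ∀ g ∈ dualitySet x, f = g := by
    rintro f ⟨hf1, hf2⟩ g ⟨hg1, hg2⟩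
    have hf : ‖f‖ = ‖x‖ := by
      rwa [sq_eq_sq₀ (norm_nonneg _) (norm_nonneg _)] at hf2
    have hg : ‖g‖ = ‖x‖ := by
      rwa [sq_eq_sq₀ (norm_nonneg _) (norm_nonneg _)] at hg2
    by_cases hx : ‖x‖ = 0
    · rw [hx, norm_eq_zero] at hf hg
      rw [hf, hg]
    · have hx : 0 < ‖x‖ := lt_of_le_of_ne (norm_nonneg _) (Ne.symm hx)
      refine eq_of_norm_eq_of_norm_add_eq (hf.trans hg.symm) (le_antisymm (norm_add_le _ _) ?_)
      have h1 : (f + g) x ≤ ‖f + g‖ * ‖x‖ := (le_abs_self _).trans ((f + g).le_opNorm x)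
      rw [add_apply, hf1, hg1] at h1
      rw [hf, hg]
      nlinarith
  exact Set.eq_singleton_iff_unique_mem.2
    ⟨(dualitySet_nonempty x).choose_spec, fun f hf => huniq f hf _
      (dualitySet_nonempty x).choose_spec⟩

/-- The Banach space adjoint `B* : X* → U` of a bounded operator `B : U → X`, where the Hilbert
space `U` is identified with its dual. -/
def adjointToHilbert {X U : Type*} [NormedAddCommGroup X] [NormedSpace ℝ X]
    [NormedAddCommGroup U] [InnerProductSpace ℝ U] [CompleteSpace U]
    (B : U →L[ℝ] X) (f : StrongDual ℝ X) : U :=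
  (InnerProductSpace.toDual ℝ U).symm (f.comp B)

/-- The data of the linear regulator problem: the uniformly bounded `C₀`-semigroup generated by the
operator `A` of the control system `ᶜD^α x = A x + B u`, `x(0) = ζ`, the control operator `B`, the
order `α`, the horizon `T`, the weight `lam` of the control cost, the initial state and the
target. -/
structure LinearRegulator (X U : Type*) [NormedAddCommGroup X] [NormedSpace ℝ X]
    [NormedAddCommGroup U] [InnerProductSpace ℝ U] where
  /-- the semigroup generated by `A` -/
  S : C0Semigroup X
  bounded : ∃ M : ℝ, ∀ t, ‖S.op t‖ ≤ M
  /-- the control operator -/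
  B : U →L[ℝ] X
  /-- the order of the Caputo derivative -/
  α : ℝ
  half_lt_α : 1 / 2 < α
  α_lt_one : α < 1
  /-- the time horizon -/
  T : ℝ
  T_pos : 0 < T
  /-- the weight `λ` of the control cost -/
  lam : ℝ
  lam_pos : 0 < lam
  /-- the initial state -/
  ζ : X
  /-- the target state -/
  xT : X

namespace LinearRegulator

variable {X U : Type*} [NormedAddCommGroup X] [NormedSpace ℝ X]
  [NormedAddCommGroup U] [InnerProductSpace ℝ U]

/-- The solution family `T_α(t) x = ∫₀^∞ ϕ_α(ξ) S(t^α ξ) x dξ`, for `t ≥ 0`. -/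
def solOp (P : LinearRegulator X U) (t : ℝ) (x : X) : X :=
  ∫ ξ in Ioi (0 : ℝ), subordDensity P.α ξ • P.S.op (t ^ P.α * ξ).toNNReal x

theorem integrable_hatOp (P : LinearRegulator X U) (t : ℝ) (x : X) :
    IntegrableOn (fun ξ : ℝ => (ξ * subordDensity P.α ξ) • P.S.op (t ^ P.α * ξ).toNNReal x)
      (Ioi 0) := by
  obtain ⟨M, hM⟩ := P.bounded
  have h := integrableOn_mul_subordDensity (q := P.α) (by linarith [P.half_lt_α]) P.α_lt_one
  refine Integrable.smul_bdd h (M * ‖x‖) ?_ ?_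
  · refine Continuous.aestronglyMeasurable ?_
    exact (P.S.continuous_orbit x).comp (continuous_real_toNNReal.comp (by fun_prop))
  · exact Eventually.of_forall fun ξ => (P.S.op _).le_of_opNorm_le (hM _) x

/-- The bounded operator `T̂_α(t) x = α ∫₀^∞ ξ ϕ_α(ξ) S(t^α ξ) x dξ`, for `t ≥ 0`. -/
def hatOp (P : LinearRegulator X U) (t : ℝ) : X →L[ℝ] X :=
  LinearMap.mkContinuousOfExistsBound
    { toFun := fun x => P.α • ∫ ξ in Ioi (0 : ℝ),
        (ξ * subordDensity P.α ξ) • P.S.op (t ^ P.α * ξ).toNNReal x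
      map_add' := fun x y => by
        simp only [map_add, smul_add]
        rw [integral_add (P.integrable_hatOp t x) (P.integrable_hatOp t y), smul_add]
      map_smul' := fun c x => by
        simp only [map_smul, RingHom.id_apply]
        rw [smul_comm c P.α, ← integral_smul c]
        simp only [smul_comm c] }
    (by
      obtain ⟨M, hM⟩ := P.bounded
      have h := integrableOn_mul_subordDensity (q := P.α) (by linarith [P.half_lt_α]) P.α_lt_one
      refine ⟨|P.α| * ((∫ ξ in Ioi (0 : ℝ), ‖ξ * subordDensity P.α ξ‖) * M), fun x => ?_⟩
      simp only [LinearMap.coe_mk, AddHom.coe_mk]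
      rw [norm_smul, Real.norm_eq_abs, mul_assoc]
      gcongr
      rw [mul_assoc, ← integral_mul_const]
      refine norm_integral_le_of_norm_le (h.norm.mul_const _) (Eventually.of_forall fun ξ => ?_)
      rw [norm_smul]
      gcongr
      exact (P.S.op _).le_of_opNorm_le (hM _) x)

/-- The Banach space adjoint `T̂_α(t)* : X* → X*`. -/
def hatOpAdjoint (P : LinearRegulator X U) (t : ℝ) (f : StrongDual ℝ X) : StrongDual ℝ X :=
  f.comp (P.hatOp t)

/-- `x` is the mild solution on `[0, T]` of the linear control system with control `u`; the formula
determines `x` on `[0, T]` (and makes it continuous there when `u ∈ L²`). -/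
def IsMildSolution (P : LinearRegulator X U) (x : ℝ → X) (u : ℝ → U) : Prop :=
  ∀ t ∈ Icc 0 P.T, x t =
    P.solOp t P.ζ + ∫ s in (0 : ℝ)..t, (t - s) ^ (P.α - 1) • P.hatOp (t - s) (P.B (u s))

/-- The admissible class: `u ∈ L²([0, T]; U)` and `x` is the mild solution with control `u`. -/
def IsAdmissible (P : LinearRegulator X U) (x : ℝ → X) (u : ℝ → U) : Prop :=
  MemLp u 2 (volume.restrict (Icc 0 P.T)) ∧ P.IsMildSolution x u

/-- The cost functional `‖x(T) - x_T‖² + λ ∫₀ᵀ ‖u(t)‖² dt`. -/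
def cost (P : LinearRegulator X U) (x : ℝ → X) (u : ℝ → U) : ℝ :=
  ‖x P.T - P.xT‖ ^ 2 + P.lam * ∫ t in (0 : ℝ)..P.T, ‖u t‖ ^ 2

/-- `(x, u)` is an optimal pair: it minimizes the cost over the admissible class. -/
def IsOptimalPair (P : LinearRegulator X U) (x : ℝ → X) (u : ℝ → U) : Prop :=
  P.IsAdmissible x u ∧ ∀ y v, P.IsAdmissible y v → P.cost x u ≤ P.cost y v

variable [CompleteSpace U]

/-- The operator `Φ₀ᵀ : X* → X`,
`Φ₀ᵀ f = ∫₀ᵀ (T-t)^(2(α-1)) T̂_α(T-t) B B* T̂_α(T-t)* f dt`. -/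
def gramian (P : LinearRegulator X U) (f : StrongDual ℝ X) : X :=
  ∫ t in (0 : ℝ)..P.T, (P.T - t) ^ (2 * (P.α - 1)) •
    P.hatOp (P.T - t) (P.B (adjointToHilbert P.B (P.hatOpAdjoint (P.T - t) f)))

/-- The map `λ I + Φ₀ᵀ J : X → X`. -/
def shiftedGramian (P : LinearRegulator X U) (z : X) : X :=
  P.lam • z + P.gramian (dualityMap z)

/-- The resolvent `R(λ, Φ₀ᵀ) = (λ I + Φ₀ᵀ J)⁻¹`, the inverse map of `shiftedGramian`
(a genuine two-sided inverse as soon as `shiftedGramian` is bijective). -/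
def resolvent (P : LinearRegulator X U) : X → X :=
  Function.invFun P.shiftedGramian

/-- The feedback law
`(T-t)^(α-1) B* T̂_α(T-t)* J[R(λ, Φ₀ᵀ)(x_T - T_α(T) ζ)]`. -/
def feedback (P : LinearRegulator X U) (t : ℝ) : U :=
  (P.T - t) ^ (P.α - 1) • adjointToHilbert P.B
    (P.hatOpAdjoint (P.T - t) (dualityMap (P.resolvent (P.xT - P.solOp P.T P.ζ))))

end LinearRegulator

end FracRegulator

end

/-!
Let `L : L²(0, T; U) → X` send a control to its contribution to the final state, and let `h` be the
target minus the free motion at time `T`. The cost is then the Tikhonov functional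
`‖h - L u‖² + λ ‖u‖²`, and `Φ₀ᵀ = L L*`. Since `‖·‖²` has directional derivative `2 J[x]`, the Euler
equation of a minimizer `u` says that `z = λ⁻¹ (h - L u)` satisfies `u = L* J[z]` and
`λ z + L L* J[z] = h`. Conversely, because `2 J[z]` is a subgradient of `‖·‖²`, any solution `z`
makes `L* J[z]` the unique minimizer. So existence of a minimizer gives surjectivity of
`λ I + Φ₀ᵀ J`, uniqueness gives injectivity, and `u = L* J[R(λ, Φ₀ᵀ) h]`.

The feedback law is continuous because `T̂_α` is norm continuous on `(0, ∞)`: the substitution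
`η = t^α ξ` moves `t` from the strongly continuous semigroup into the integrable density, and
dilations act continuously on `L¹`.
-/

noncomputable section

open MeasureTheory Set Filter Topology
open scoped ENNReal

namespace FracRegulator

section DualityMap

variable {X : Type*} [NormedAddCommGroup X] [NormedSpace ℝ X]

theorem dualityMap_mem (x : X) : dualityMap x ∈ dualitySet x :=
  (dualitySet_nonempty x).choose_spec

theorem norm_eq_of_mem_dualitySet {x : X} {f : StrongDual ℝ X} (hf : f ∈ dualitySet x) :
    ‖f‖ = ‖x‖ :=
  (sq_eq_sq₀ (norm_nonneg _) (norm_nonneg _)).1 hf.2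

theorem mem_dualitySet_of_norm_le {x : X} {f : StrongDual ℝ X} (hfx : f x = ‖x‖ ^ 2)
    (hf : ‖f‖ ≤ ‖x‖) : f ∈ dualitySet x := by
  have hle : ‖x‖ ^ 2 ≤ ‖f‖ * ‖x‖ := hfx ▸ (le_abs_self _).trans (f.le_opNorm x)
  exact ⟨hfx, by nlinarith [norm_nonneg f]⟩

theorem smul_mem_dualitySet {x : X} {f : StrongDual ℝ X} (c : ℝ) (hf : f ∈ dualitySet x) :
    c • f ∈ dualitySet (c • x) := by
  refine mem_dualitySet_of_norm_le ?_ (by rw [norm_smul, norm_smul, norm_eq_of_mem_dualitySet hf])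
  rw [smul_apply, map_smul, hf.1, norm_smul, mul_pow, Real.norm_eq_abs, sq_abs, smul_eq_mul,
    smul_eq_mul, ← mul_assoc, ← sq]

theorem two_mul_apply_sub_le_of_mem_dualitySet {y : X} {f : StrongDual ℝ X}
    (hf : f ∈ dualitySet y) (x : X) : 2 * f (x - y) ≤ ‖x‖ ^ 2 - ‖y‖ ^ 2 := by
  have hfx : f x ≤ ‖y‖ * ‖x‖ :=
    norm_eq_of_mem_dualitySet hf ▸ (le_abs_self _).trans (f.le_opNorm x)
  rw [map_sub, hf.1]
  nlinarith [sq_nonneg (‖x‖ - ‖y‖)]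

theorem mem_dualitySet_of_tendsto {ι : Type*} {l : Filter ι} [l.NeBot] {y : ι → X}
    {g : ι → StrongDual ℝ X} {x : X} {f : StrongDual ℝ X} (hg : ∀ i, g i ∈ dualitySet (y i))
    (hy : Tendsto y l (𝓝 x)) (hgf : ∀ v, Tendsto (fun i ↦ g i v) l (𝓝 (f v))) :
    f ∈ dualitySet x := by
  have bound (i : ι) (v : X) : ‖g i v‖ ≤ ‖y i‖ * ‖v‖ :=
    norm_eq_of_mem_dualitySet (hg i) ▸ (g i).le_opNorm v
  refine mem_dualitySet_of_norm_le ?_ ?_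
  · have herr : Tendsto (fun i ↦ g i (y i - x)) l (𝓝 0) := by
      refine squeeze_zero_norm (fun i ↦ bound i (y i - x)) ?_
      simpa using hy.norm.mul (hy.sub_const x).norm
    refine tendsto_nhds_unique (hgf x) ?_
    simpa [(hg _).1] using (hy.norm.pow 2).sub herr
  · exact f.opNorm_le_bound (norm_nonneg x) fun v ↦
      le_of_tendsto_of_tendsto' (hgf v).norm (hy.norm.mul_const ‖v‖) fun i ↦ bound i v

variable [StrictConvexSpace ℝ (StrongDual ℝ X)]

theorem eq_dualityMap {x : X} {f : StrongDual ℝ X} (hf : f ∈ dualitySet x) : f = dualityMap x := by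
  rwa [dualitySet_eq_singleton] at hf

theorem dualityMap_smul (c : ℝ) (x : X) : dualityMap (c • x) = c • dualityMap x :=
  (eq_dualityMap (smul_mem_dualitySet c (dualityMap_mem x))).symm

theorem continuous_toWeakDual_dualityMap :
    Continuous fun x : X ↦ StrongDual.toWeakDual (dualityMap x) := by
  refine continuous_iff_ultrafilter.2 fun x l hl ↦ ?_
  have hbdd : ∀ᶠ z in (l : Filter X), StrongDual.toWeakDual (dualityMap z) ∈
      WeakDual.toStrongDual ⁻¹' Metric.closedBall (0 : StrongDual ℝ X) (‖x‖ + 1) := by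
    filter_upwards [hl (Metric.ball_mem_nhds x one_pos)] with z hz
    have hzx : ‖z - x‖ < 1 := by simpa [dist_eq_norm] using hz
    have hz1 : ‖z‖ ≤ ‖x‖ + 1 := by linarith [norm_le_norm_add_norm_sub' z x]
    simpa [norm_eq_of_mem_dualitySet (dualityMap_mem z)] using hz1
  obtain ⟨f, -, hf⟩ := (WeakDual.isCompact_closedBall (𝕜 := ℝ) (0 : StrongDual ℝ X)
    (‖x‖ + 1)).ultrafilter_le_nhds (l.map fun z ↦ StrongDual.toWeakDual (dualityMap z))
    (le_principal_iff.2 hbdd)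
  have hlim : WeakDual.toStrongDual f = dualityMap x :=
    eq_dualityMap <| mem_dualitySet_of_tendsto dualityMap_mem hl fun v ↦
      ((WeakDual.eval_continuous v).tendsto f).comp hf
  rwa [← hlim]

theorem hasLineDerivAt_norm_sq (x y : X) :
    HasLineDerivAt ℝ (fun z : X ↦ ‖z‖ ^ 2) (2 * dualityMap x y) x y := by
  have hsecant (t : ℝ) : ‖‖x + t • y‖ ^ 2 - ‖x‖ ^ 2 - t * (2 * dualityMap x y)‖ ≤
      ‖2 * (dualityMap (x + t • y) y - dualityMap x y) * t‖ := by
    have lower := two_mul_apply_sub_le_of_mem_dualitySet (dualityMap_mem x) (x + t • y)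
    have upper := two_mul_apply_sub_le_of_mem_dualitySet (dualityMap_mem (x + t • y)) x
    simp only [add_sub_cancel_left, sub_add_cancel_left, map_neg, map_smul, smul_eq_mul]
      at lower upper
    rw [Real.norm_of_nonneg (by linarith)]
    exact (by linarith : _ ≤ _).trans (le_abs_self _)
  have hcont : Continuous fun t : ℝ ↦ dualityMap (x + t • y) y :=
    (WeakDual.eval_continuous y).comp (continuous_toWeakDual_dualityMap.comp (by fun_prop))
  have hlim : Tendsto (fun t : ℝ ↦ 2 * (dualityMap (x + t • y) y - dualityMap x y)) (𝓝 0)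
      (𝓝 0) := by
    simpa using ((hcont.tendsto 0).sub_const (dualityMap x y)).const_mul 2
  refine hasDerivAt_iff_isLittleO.2 ?_
  simp only [zero_smul, add_zero, sub_zero, smul_eq_mul]
  refine (Asymptotics.isBigO_of_le _ hsecant).trans_isLittleO ?_
  simpa using ((Asymptotics.isLittleO_one_iff ℝ).2 hlim).mul_isBigO (Asymptotics.isBigO_refl _ _)

end DualityMap

section Tikhonov

variable {X H : Type*} [NormedAddCommGroup X] [NormedSpace ℝ X]
  [NormedAddCommGroup H] [InnerProductSpace ℝ H]

theorem exists_isMinOn_sq_add_norm_sq [CompleteSpace H] {g : H → ℝ} (hg : ConvexOn ℝ univ g)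
    (hlsc : LowerSemicontinuous g) (hg0 : 0 ≤ g) :
    ∃ u, IsMinOn (fun v ↦ g v ^ 2 + ‖v‖ ^ 2) univ u := by
  -- `‖(v, s)‖² = ‖v‖² + s²`, so the projection of `0` on the epigraph of `g` is a minimizer.
  let e := WithLp.prodContinuousLinearEquiv 2 ℝ H ℝ
  let K : Set (WithLp 2 (H × ℝ)) := e ⁻¹' {p | g p.1 ≤ p.2}
  have hne : K.Nonempty := ⟨e.symm (0, g 0), by simp [K]⟩
  have hclosed : IsClosed K := hlsc.isClosed_epigraph.preimage e.continuous
  have hconvex : Convex ℝ K := by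
    simpa [K, preimage_ofPred_eq] using hg.convex_epigraph.linear_preimage e.toLinearMap
  obtain ⟨p, hpK, hp⟩ := exists_norm_eq_iInf_of_complete_convex hne hclosed.isComplete hconvex 0
  refine ⟨p.fst, fun v _ ↦ ?_⟩
  have hmin : ‖p‖ ≤ ‖e.symm (v, g v)‖ := by
    have hv : e.symm (v, g v) ∈ K := by simp [K]
    have hle := ciInf_le (f := fun w : K ↦ ‖0 - (w : WithLp 2 (H × ℝ))‖)
      ⟨0, by rintro _ ⟨w, rfl⟩; positivity⟩ ⟨_, hv⟩
    rwa [← hp, zero_sub, norm_neg, zero_sub, norm_neg] at hle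
  have hvalue : g p.fst ^ 2 + ‖p.fst‖ ^ 2 ≤ ‖p‖ ^ 2 := by
    have hgp : g p.fst ^ 2 ≤ p.snd ^ 2 := pow_le_pow_left₀ (hg0 _) hpK 2
    rw [WithLp.prod_norm_sq_eq_of_L2, Real.norm_eq_abs, sq_abs]
    linarith
  have hv : ‖e.symm (v, g v)‖ ^ 2 = g v ^ 2 + ‖v‖ ^ 2 := by
    simp [e, WithLp.prod_norm_sq_eq_of_L2, add_comm]
  exact hvalue.trans ((pow_le_pow_left₀ (norm_nonneg _) hmin 2).trans_eq hv)

/-- The Tikhonov functional `‖h - L u‖² + c ‖u‖²`, a penalized least squares cost for the equation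
`L u = h`. -/
def tikhonov (L : H →L[ℝ] X) (c : ℝ) (h : X) (u : H) : ℝ :=
  ‖h - L u‖ ^ 2 + c * ‖u‖ ^ 2

theorem exists_isMinOn_tikhonov [CompleteSpace H] (L : H →L[ℝ] X) {c : ℝ} (hc : 0 < c) (h : X) :
    ∃ u, IsMinOn (tikhonov L c h) univ u := by
  have hconvex : ConvexOn ℝ univ fun u ↦ (√c)⁻¹ * ‖h - L u‖ := by
    have hnorm : ConvexOn ℝ univ fun u ↦ ‖h - L u‖ := by
      simpa [Function.comp_def] using convexOn_univ_norm.comp_affineMap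
        (AffineMap.const ℝ H h - L.toLinearMap.toAffineMap)
    exact hnorm.smul (by positivity)
  have hcont : Continuous fun u ↦ (√c)⁻¹ * ‖h - L u‖ := by fun_prop
  obtain ⟨u, hu⟩ := exists_isMinOn_sq_add_norm_sq hconvex hcont.lowerSemicontinuous
    fun u ↦ by positivity
  have hscale (v : H) :
      tikhonov L c h v = c * (((√c)⁻¹ * ‖h - L v‖) ^ 2 + ‖v‖ ^ 2) := by
    rw [tikhonov, mul_pow, inv_pow, Real.sq_sqrt hc.le]
    field_simp
  refine ⟨u, fun v hv ↦ ?_⟩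
  simp only [mem_ofPred_eq, hscale]
  exact mul_le_mul_of_nonneg_left (hu hv) hc.le

theorem hasLineDerivAt_tikhonov [StrictConvexSpace ℝ (StrongDual ℝ X)] (L : H →L[ℝ] X) (c : ℝ)
    (h : X) (u v : H) :
    HasLineDerivAt ℝ (tikhonov L c h)
      (2 * dualityMap (h - L u) (L (-v)) + c * (2 * inner ℝ u v)) u v := by
  have hline : HasDerivAt (fun t : ℝ ↦ u + t • v) v 0 := by
    simpa using ((hasDerivAt_id (0 : ℝ)).smul_const v).const_add u
  have hpenalty : HasDerivAt (fun t : ℝ ↦ c * ‖u + t • v‖ ^ 2) (c * (2 * inner ℝ u v)) 0 := by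
    simpa using hline.norm_sq.const_mul c
  have hresidual (t : ℝ) : h - L u + t • L (-v) = h - L (u + t • v) := by
    simp only [map_neg, smul_neg, map_add, map_smul]; abel
  have hfit := hasLineDerivAt_norm_sq (h - L u) (L (-v))
  simp only [HasLineDerivAt, hresidual] at hfit
  exact hfit.add hpenalty

variable [CompleteSpace H]

theorem inner_adjointToHilbert (L : H →L[ℝ] X) (f : StrongDual ℝ X) (v : H) :
    inner ℝ (adjointToHilbert L f) v = f (L v) := by
  simp [adjointToHilbert]

theorem eq_adjointToHilbert {L : H →L[ℝ] X} {f : StrongDual ℝ X} {u : H}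
    (hu : ∀ v, inner ℝ u v = f (L v)) : u = adjointToHilbert L f :=
  ext_inner_right ℝ fun v ↦ by rw [hu, inner_adjointToHilbert]

/-- The map `c I + L L* J : X → X` of the normal equation of `tikhonov L c h`: a solution `z` of
`shiftedNormalMap L c z = h` yields the minimizer `L* J[z]`. -/
def shiftedNormalMap (L : H →L[ℝ] X) (c : ℝ) (z : X) : X :=
  c • z + L (adjointToHilbert L (dualityMap z))

theorem shiftedNormalMap_residual_of_isMinOn [StrictConvexSpace ℝ (StrongDual ℝ X)]
    {L : H →L[ℝ] X} {c : ℝ} (hc : c ≠ 0) {h : X} {u : H} (hu : IsMinOn (tikhonov L c h) univ u) :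
    shiftedNormalMap L c (c⁻¹ • (h - L u)) = h := by
  have heuler (v : H) : dualityMap (h - L u) (L v) = c * inner ℝ u v := by
    have hcritical := hu.hasLineDerivAt_eq_zero (hasLineDerivAt_tikhonov L c h u v) (by simp)
    rw [map_neg, map_neg] at hcritical
    linarith
  have hadjoint : u = adjointToHilbert L (dualityMap (c⁻¹ • (h - L u))) :=
    eq_adjointToHilbert fun v ↦ by
      rw [dualityMap_smul, smul_apply, heuler, smul_eq_mul, inv_mul_cancel_left₀ hc]
  rw [shiftedNormalMap, ← hadjoint, smul_inv_smul₀ hc, sub_add_cancel]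

theorem tikhonov_add_le_of_shiftedNormalMap_eq {L : H →L[ℝ] X} {c : ℝ} {h z : X}
    (hz : shiftedNormalMap L c z = h) (v : H) :
    tikhonov L c h (adjointToHilbert L (dualityMap z)) +
      c * ‖v - adjointToHilbert L (dualityMap z)‖ ^ 2 ≤ tikhonov L c h v := by
  set u := adjointToHilbert L (dualityMap z) with hu
  have hcz : h - L u = c • z := sub_eq_of_eq_add hz.symm
  have hsub := two_mul_apply_sub_le_of_mem_dualitySet
    (smul_mem_dualitySet c (dualityMap_mem z)) (h - L v)
  have hinner : (c • dualityMap z) (h - L v - c • z) = c * (‖u‖ ^ 2 - inner ℝ u v) := by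
    rw [← hcz, sub_sub_sub_cancel_left, ← map_sub, smul_apply, ← inner_adjointToHilbert, ← hu,
      inner_sub_right, real_inner_self_eq_norm_sq, smul_eq_mul]
  rw [tikhonov, tikhonov, hcz, norm_sub_sq_real, real_inner_comm]
  linarith

theorem eq_adjointToHilbert_of_isMinOn {L : H →L[ℝ] X} {c : ℝ} (hc : 0 < c) {h z : X} {u : H}
    (hu : IsMinOn (tikhonov L c h) univ u) (hz : shiftedNormalMap L c z = h) :
    u = adjointToHilbert L (dualityMap z) := by
  have hstrict := tikhonov_add_le_of_shiftedNormalMap_eq hz u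
  have hmin : tikhonov L c h u ≤ tikhonov L c h (adjointToHilbert L (dualityMap z)) :=
    hu (mem_univ _)
  have hzero : ‖u - adjointToHilbert L (dualityMap z)‖ ^ 2 ≤ 0 := by nlinarith
  exact sub_eq_zero.1 (norm_eq_zero.1 (sq_nonpos_iff _ |>.1 hzero))

theorem isMinOn_adjointToHilbert {L : H →L[ℝ] X} {c : ℝ} (hc : 0 ≤ c) {h z : X}
    (hz : shiftedNormalMap L c z = h) :
    IsMinOn (tikhonov L c h) univ (adjointToHilbert L (dualityMap z)) := fun v _ ↦
  (le_add_of_nonneg_right (by positivity)).trans (tikhonov_add_le_of_shiftedNormalMap_eq hz v)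

theorem shiftedNormalMap_injective (L : H →L[ℝ] X) {c : ℝ} (hc : 0 < c) :
    Function.Injective (shiftedNormalMap L c) := by
  intro z w hzw
  have hcontrol : adjointToHilbert L (dualityMap z) = adjointToHilbert L (dualityMap w) :=
    eq_adjointToHilbert_of_isMinOn hc (isMinOn_adjointToHilbert hc.le hzw) rfl
  rw [shiftedNormalMap, shiftedNormalMap, hcontrol] at hzw
  exact smul_right_injective X hc.ne' (add_right_cancel hzw)

theorem shiftedNormalMap_bijective [StrictConvexSpace ℝ (StrongDual ℝ X)] (L : H →L[ℝ] X) {c : ℝ}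
    (hc : 0 < c) : Function.Bijective (shiftedNormalMap L c) := by
  refine ⟨shiftedNormalMap_injective L hc, fun h ↦ ?_⟩
  obtain ⟨u, hu⟩ := exists_isMinOn_tikhonov L hc h
  exact ⟨_, shiftedNormalMap_residual_of_isMinOn hc.ne' hu⟩

end Tikhonov

section Dilation

open Module

variable {E F : Type*} [NormedAddCommGroup E] [NormedSpace ℝ E] [FiniteDimensional ℝ E]
  [MeasurableSpace E] [BorelSpace E] {μ : Measure E} [μ.IsAddHaarMeasure]
  [NormedAddCommGroup F]

theorem integral_norm_comp_smul_sub_le {f g : E → F} (hf : Integrable f μ) (hg : Integrable g μ)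
    {r s : ℝ} (hr : r ≠ 0) (hs : s ≠ 0) :
    ∫ x, ‖f (r • x) - f (s • x)‖ ∂μ ≤ ∫ x, ‖g (r • x) - g (s • x)‖ ∂μ +
      (|(r ^ finrank ℝ E)⁻¹| + |(s ^ finrank ℝ E)⁻¹|) * ∫ x, ‖f x - g x‖ ∂μ := by
  have hscale (c : ℝ) : ∫ x, ‖f (c • x) - g (c • x)‖ ∂μ =
      |(c ^ finrank ℝ E)⁻¹| * ∫ x, ‖f x - g x‖ ∂μ :=
    Measure.integral_comp_smul μ (fun x ↦ ‖f x - g x‖) c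
  have hfg {c : ℝ} (hc : c ≠ 0) : Integrable (fun x ↦ ‖f (c • x) - g (c • x)‖) μ :=
    ((hf.comp_smul hc).sub (hg.comp_smul hc)).norm
  have hgrs : Integrable (fun x ↦ ‖g (r • x) - g (s • x)‖) μ :=
    ((hg.comp_smul hr).sub (hg.comp_smul hs)).norm
  have hfg_add : Integrable (fun x ↦ ‖f (r • x) - g (r • x)‖ + ‖f (s • x) - g (s • x)‖) μ :=
    (hfg hr).add (hfg hs)
  rw [add_mul, ← hscale, ← hscale, ← integral_add (hfg hr) (hfg hs), ← integral_add hgrs hfg_add]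
  refine integral_mono ((hf.comp_smul hr).sub (hf.comp_smul hs)).norm (hgrs.add hfg_add)
    fun x ↦ ?_
  calc ‖f (r • x) - f (s • x)‖
      = ‖(g (r • x) - g (s • x)) +
          ((f (r • x) - g (r • x)) - (f (s • x) - g (s • x)))‖ := by congr 1; abel
    _ ≤ _ := (norm_add_le _ _).trans (add_le_add_right (norm_sub_le _ _) _)

theorem tendsto_integral_norm_comp_smul_sub_of_hasCompactSupport {g : E → F} (hg : Continuous g)
    (hgs : HasCompactSupport g) {r₀ : ℝ} (hr₀ : r₀ ≠ 0) :
    Tendsto (fun r : ℝ ↦ ∫ x, ‖g (r • x) - g (r₀ • x)‖ ∂μ) (𝓝 r₀) (𝓝 0) := by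
  obtain ⟨R, hR⟩ := hgs.isCompact.isBounded.subset_closedBall (0 : E)
  have hzero {r : ℝ} (hr : |r₀| / 2 < |r|) {x : E} (hx : x ∉ Metric.closedBall 0 (R / (|r₀| / 2))) :
      g (r • x) = 0 := by
    have hr₀' : 0 < |r₀| / 2 := by positivity
    refine image_eq_zero_of_notMem_tsupport fun hmem ↦ hx ?_
    have hle : |r| * ‖x‖ ≤ R := by
      simpa [norm_smul] using hR hmem
    rw [mem_closedBall_zero_iff, le_div_iff₀' hr₀']
    exact (mul_le_mul_of_nonneg_right hr.le (norm_nonneg x)).trans hle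
  have hr₀_mem : |r₀| / 2 < |r₀| := half_lt_self (abs_pos.2 hr₀)
  have hcont : ContinuousOn (fun r : ℝ ↦ ∫ x, ‖g (r • x) - g (r₀ • x)‖ ∂μ)
      {r | |r₀| / 2 < |r|} := by
    refine continuousOn_integral_of_compact_support (isCompact_closedBall 0 (R / (|r₀| / 2)))
      (by unfold Function.uncurry; fun_prop) fun r x hr hx ↦ ?_
    rw [hzero hr hx, hzero hr₀_mem hx, sub_self, norm_zero]
  have hopen : IsOpen {r : ℝ | |r₀| / 2 < |r|} := isOpen_lt continuous_const continuous_abs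
  simpa using (hcont.continuousAt (hopen.mem_nhds hr₀_mem)).tendsto

theorem tendsto_integral_norm_comp_smul_sub [NormedSpace ℝ F] {f : E → F} (hf : Integrable f μ)
    {r₀ : ℝ} (hr₀ : r₀ ≠ 0) :
    Tendsto (fun r : ℝ ↦ ∫ x, ‖f (r • x) - f (r₀ • x)‖ ∂μ) (𝓝 r₀) (𝓝 0) := by
  let c : ℝ → ℝ := fun r ↦ |(r ^ finrank ℝ E)⁻¹| + |(r₀ ^ finrank ℝ E)⁻¹|
  have hc : ContinuousAt c r₀ := by
    have : r₀ ^ finrank ℝ E ≠ 0 := pow_ne_zero _ hr₀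
    fun_prop (disch := assumption)
  refine NormedAddGroup.tendsto_nhds_zero.2 fun ε hε ↦ ?_
  have hc₀ : 0 < c r₀ + 1 := by positivity
  obtain ⟨g, hgs, hfg, hgc, hg⟩ :=
    hf.exists_hasCompactSupport_integral_sub_le (show 0 < ε / 2 / (c r₀ + 1) by positivity)
  have hlim := tendsto_integral_norm_comp_smul_sub_of_hasCompactSupport (μ := μ) hgc hgs hr₀
  filter_upwards [hlim.eventually_lt_const (half_pos hε), hc.eventually_lt_const (lt_add_one _),
    eventually_ne_nhds hr₀] with r hr hcr hr0
  rw [Real.norm_of_nonneg (integral_nonneg fun _ ↦ norm_nonneg _)]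
  calc ∫ x, ‖f (r • x) - f (r₀ • x)‖ ∂μ
      ≤ ∫ x, ‖g (r • x) - g (r₀ • x)‖ ∂μ + c r * ∫ x, ‖f x - g x‖ ∂μ :=
        integral_norm_comp_smul_sub_le hf hg hr0 hr₀
    _ ≤ ∫ x, ‖g (r • x) - g (r₀ • x)‖ ∂μ + (c r₀ + 1) * (ε / 2 / (c r₀ + 1)) := by gcongr
    _ < ε / 2 + ε / 2 := by rw [mul_div_cancel₀ _ hc₀.ne']; gcongr
    _ = ε := add_halves ε

theorem tendsto_setIntegral_norm_comp_mul_sub [NormedSpace ℝ F] {m : ℝ → F}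
    (hm : IntegrableOn m (Ioi 0)) {s₀ : ℝ} (hs₀ : 0 < s₀) :
    Tendsto (fun s ↦ ∫ η in Ioi 0, ‖m (s * η) - m (s₀ * η)‖) (𝓝 s₀) (𝓝 0) := by
  have hlim := tendsto_integral_norm_comp_smul_sub
    ((integrable_indicator_iff measurableSet_Ioi).2 hm) hs₀.ne'
  refine hlim.congr' ?_
  filter_upwards [lt_mem_nhds hs₀] with s hs
  rw [← integral_indicator measurableSet_Ioi]
  refine integral_congr_ae (Eventually.of_forall fun η ↦ ?_)
  by_cases hη : 0 < η <;> simp [hη, hs, hs₀]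

end Dilation

theorem norm_integral_smul_le {Ω X : Type*} [MeasurableSpace Ω] {μ : Measure Ω}
    [NormedAddCommGroup X] [NormedSpace ℝ X] {k : Ω → ℝ} {g : Ω → X} {C : ℝ}
    (hk : Integrable k μ) (hg : ∀ ω, ‖g ω‖ ≤ C) :
    ‖∫ ω, k ω • g ω ∂μ‖ ≤ (∫ ω, ‖k ω‖ ∂μ) * C := by
  rw [← integral_mul_const]
  refine norm_integral_le_of_norm_le (hk.norm.mul_const C) (Eventually.of_forall fun ω ↦ ?_)
  rw [norm_smul]
  gcongr
  exact hg ω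

/-- The first moment density `ξ φ_q(ξ)`, the weight of the semigroup in `LinearRegulator.hatOp`. -/
def momentDensity (q ξ : ℝ) : ℝ :=
  ξ * subordDensity q ξ

theorem integrableOn_momentDensity_comp_mul {q s : ℝ} (hq₀ : 0 < q) (hq₁ : q < 1) (hs : 0 < s) :
    IntegrableOn (fun η ↦ momentDensity q (s * η)) (Ioi 0) := by
  rw [integrableOn_Ioi_comp_mul_left_iff (momentDensity q) _ hs, mul_zero]
  exact integrableOn_mul_subordDensity hq₀ hq₁

namespace LinearRegulator

variable {X U : Type*} [NormedAddCommGroup X] [NormedSpace ℝ X]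
  [NormedAddCommGroup U] [InnerProductSpace ℝ U]

theorem α_pos (P : LinearRegulator X U) : 0 < P.α :=
  one_half_pos.trans P.half_lt_α

theorem hatOp_apply (P : LinearRegulator X U) (t : ℝ) (x : X) :
    P.hatOp t x =
      P.α • ∫ ξ in Ioi 0, momentDensity P.α ξ • P.S.op (t ^ P.α * ξ).toNNReal x :=
  rfl

theorem exists_norm_hatOp_le (P : LinearRegulator X U) : ∃ C, ∀ t, ‖P.hatOp t‖ ≤ C := by
  obtain ⟨M, hM⟩ := P.bounded
  have hM₀ : 0 ≤ M := (norm_nonneg _).trans (hM 0)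
  have hα := P.α_pos
  refine ⟨P.α * ((∫ ξ in Ioi 0, ‖momentDensity P.α ξ‖) * M), fun t ↦
    ContinuousLinearMap.opNorm_le_bound _ (by positivity) fun x ↦ ?_⟩
  rw [hatOp_apply, norm_smul, Real.norm_of_nonneg hα.le, mul_assoc, mul_assoc]
  gcongr
  exact norm_integral_smul_le (integrableOn_mul_subordDensity hα P.α_lt_one) fun ξ ↦
    (P.S.op _).le_of_opNorm_le (hM _) x

theorem rpow_smul_hatOp_apply (P : LinearRegulator X U) {t : ℝ} (ht : 0 < t) (x : X) :
    t ^ P.α • P.hatOp t x =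
      P.α • ∫ η in Ioi 0, momentDensity P.α ((t ^ P.α)⁻¹ * η) • P.S.op η.toNNReal x := by
  have hs : 0 < t ^ P.α := by positivity
  have hsubst := integral_comp_mul_left_Ioi
    (fun ξ ↦ momentDensity P.α ξ • P.S.op (t ^ P.α * ξ).toNNReal x) 0 (inv_pos.2 hs)
  simp only [mul_inv_cancel_left₀ hs.ne', inv_inv, mul_zero] at hsubst
  rw [hsubst, hatOp_apply, smul_comm]

theorem integrableOn_momentDensity_comp_mul_smul (P : LinearRegulator X U) {s : ℝ} (hs : 0 < s)
    (x : X) :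
    IntegrableOn (fun η ↦ momentDensity P.α (s * η) • P.S.op η.toNNReal x) (Ioi 0) := by
  obtain ⟨M, hM⟩ := P.bounded
  refine (integrableOn_momentDensity_comp_mul P.α_pos P.α_lt_one hs).smul_bdd (M * ‖x‖)
    ?_ (Eventually.of_forall fun η ↦ (P.S.op _).le_of_opNorm_le (hM _) x)
  exact ((P.S.continuous_orbit x).comp continuous_real_toNNReal).aestronglyMeasurable

theorem norm_rpow_smul_hatOp_sub_le (P : LinearRegulator X U) {M : ℝ} (hM : ∀ t, ‖P.S.op t‖ ≤ M)
    {s t : ℝ} (hs : 0 < s) (ht : 0 < t) :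
    ‖t ^ P.α • P.hatOp t - s ^ P.α • P.hatOp s‖ ≤ P.α * M *
      ∫ η in Ioi 0,
        ‖momentDensity P.α ((t ^ P.α)⁻¹ * η) - momentDensity P.α ((s ^ P.α)⁻¹ * η)‖ := by
  have hM₀ : 0 ≤ M := (norm_nonneg _).trans (hM 0)
  have hα := P.α_pos
  have hs' : 0 < (s ^ P.α)⁻¹ := by positivity
  have ht' : 0 < (t ^ P.α)⁻¹ := by positivity
  refine ContinuousLinearMap.opNorm_le_bound _ (by positivity) fun x ↦ ?_
  rw [sub_apply, smul_apply, smul_apply, P.rpow_smul_hatOp_apply ht, P.rpow_smul_hatOp_apply hs,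
    ← smul_sub, ← integral_sub (P.integrableOn_momentDensity_comp_mul_smul ht' x)
      (P.integrableOn_momentDensity_comp_mul_smul hs' x), norm_smul, Real.norm_of_nonneg hα.le,
    mul_assoc, mul_assoc, mul_left_comm M]
  simp only [← sub_smul]
  gcongr
  exact norm_integral_smul_le ((integrableOn_momentDensity_comp_mul hα P.α_lt_one ht').sub
    (integrableOn_momentDensity_comp_mul hα P.α_lt_one hs')) fun η ↦
      (P.S.op _).le_of_opNorm_le (hM _) x

theorem continuousOn_hatOp (P : LinearRegulator X U) : ContinuousOn P.hatOp (Ioi 0) := by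
  obtain ⟨M, hM⟩ := P.bounded
  refine isOpen_Ioi.continuousOn_iff.2 fun {t₀} (ht₀ : 0 < t₀) ↦ ?_
  have hpow : Tendsto (fun t : ℝ ↦ (t ^ P.α)⁻¹) (𝓝 t₀) (𝓝 (t₀ ^ P.α)⁻¹) :=
    (Real.continuousAt_rpow_const t₀ P.α (.inl ht₀.ne')).inv₀ (by positivity)
  have hdilation := ((tendsto_setIntegral_norm_comp_mul_sub
    (integrableOn_mul_subordDensity P.α_pos P.α_lt_one)
    (show 0 < (t₀ ^ P.α)⁻¹ by positivity)).comp hpow).const_mul (P.α * M)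
  rw [mul_zero] at hdilation
  have hscaled : Tendsto (fun t ↦ t ^ P.α • P.hatOp t) (𝓝 t₀) (𝓝 (t₀ ^ P.α • P.hatOp t₀)) := by
    refine tendsto_iff_norm_sub_tendsto_zero.2 (squeeze_zero' (Eventually.of_forall fun _ ↦
      norm_nonneg _) ?_ hdilation)
    filter_upwards [lt_mem_nhds ht₀] with t ht
    exact P.norm_rpow_smul_hatOp_sub_le hM ht₀ ht
  have hlim := hpow.smul hscaled
  rw [inv_smul_smul₀ (by positivity)] at hlim
  refine hlim.congr' ?_
  filter_upwards [lt_mem_nhds ht₀] with t ht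
  rw [inv_smul_smul₀ (by positivity)]

end LinearRegulator

section KernelOp

variable {Ω X U : Type*} [MeasurableSpace Ω] {μ : Measure Ω}
  [NormedAddCommGroup X] [NormedSpace ℝ X] [NormedAddCommGroup U]

theorem norm_toLp_two_sq {w : Ω → U} (hw : MemLp w 2 μ) :
    ‖hw.toLp w‖ ^ 2 = ∫ ω, ‖w ω‖ ^ 2 ∂μ := by
  have hnonneg : 0 ≤ ∫ ω, ‖w ω‖ ^ 2 ∂μ := integral_nonneg fun _ ↦ sq_nonneg _
  rw [Lp.norm_toLp, hw.eLpNorm_eq_integral_rpow_norm two_ne_zero ENNReal.ofNat_ne_top,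
    ENNReal.toReal_ofReal (by positivity)]
  simp only [ENNReal.toReal_ofNat, Real.rpow_two]
  exact_mod_cast Real.rpow_inv_natCast_pow hnonneg two_ne_zero

variable [InnerProductSpace ℝ U] {k : Ω → U →L[ℝ] X}

/-- The operator `v ↦ ∫ k(ω) v(ω) dμ(ω)` on `L²(μ; U)` defined by a square integrable
operator-valued kernel `k`. -/
def kernelOp [CompleteSpace X] (hk : MemLp k 2 μ) : Lp U 2 μ →L[ℝ] X :=
  (ContinuousLinearMap.id ℝ (U →L[ℝ] X)).lpPairing μ 2 2 hk.toLp

theorem kernelOp_apply [CompleteSpace X] (hk : MemLp k 2 μ) {v : Lp U 2 μ} {w : Ω → U}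
    (hvw : v =ᵐ[μ] w) : kernelOp hk v = ∫ ω, k ω (w ω) ∂μ := by
  rw [kernelOp, ContinuousLinearMap.lpPairing_eq_integral]
  refine integral_congr_ae ?_
  filter_upwards [hk.coeFn_toLp, hvw] with ω hkω hvω
  rw [hkω, hvω, ContinuousLinearMap.id_apply]

variable [CompleteSpace U]

theorem norm_adjointToHilbert_le (L : U →L[ℝ] X) (f : StrongDual ℝ X) :
    ‖adjointToHilbert L f‖ ≤ ‖f‖ * ‖L‖ := by
  rw [adjointToHilbert, LinearIsometryEquiv.norm_map]
  exact f.opNorm_comp_le L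

theorem continuous_adjointToHilbert_left (f : StrongDual ℝ X) :
    Continuous fun L : U →L[ℝ] X ↦ adjointToHilbert L f :=
  (InnerProductSpace.toDual ℝ U).symm.continuous.comp
    (ContinuousLinearMap.compL ℝ U X ℝ f).continuous

theorem memLp_adjointToHilbert {p : ℝ≥0∞} (hk : MemLp k p μ) (f : StrongDual ℝ X) :
    MemLp (fun ω ↦ adjointToHilbert (k ω) f) p μ :=
  hk.of_le_mul ((continuous_adjointToHilbert_left f).comp_aestronglyMeasurable hk.1)
    (Eventually.of_forall fun ω ↦ norm_adjointToHilbert_le (k ω) f)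

theorem adjointToHilbert_kernelOp [CompleteSpace X] (hk : MemLp k 2 μ) (f : StrongDual ℝ X) :
    (adjointToHilbert (kernelOp hk) f : Lp U 2 μ) =ᵐ[μ] fun ω ↦ adjointToHilbert (k ω) f := by
  have hkf := memLp_adjointToHilbert hk f
  have hadjoint : hkf.toLp _ = adjointToHilbert (kernelOp hk) f := by
    refine eq_adjointToHilbert fun v ↦ ?_
    have hint : Integrable (fun ω ↦ k ω (v ω)) μ := memLp_one_iff_integrable.1
      ((ContinuousLinearMap.id ℝ (U →L[ℝ] X)).memLp_of_bilin 1 hk (Lp.memLp v))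
    rw [kernelOp_apply hk (EventuallyEq.refl _ v), ← f.integral_comp_comm hint, L2.inner_def]
    refine integral_congr_ae ?_
    filter_upwards [hkf.coeFn_toLp] with ω hω
    rw [hω, inner_adjointToHilbert]
  exact hadjoint ▸ hkf.coeFn_toLp

end KernelOp

theorem memLp_two_rpow_sub {T a : ℝ} (hT : 0 ≤ T) (ha : -1 / 2 < a) :
    MemLp (fun t ↦ (T - t) ^ a) 2 (volume.restrict (Ioc 0 T)) := by
  have hmeas : Measurable fun t ↦ (T - t) ^ a := by fun_prop
  rw [memLp_two_iff_integrable_sq hmeas.aestronglyMeasurable]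
  have hint : IntervalIntegrable (fun t ↦ (T - t) ^ (2 * a)) volume 0 T := by
    have hrpow : IntervalIntegrable (fun t ↦ t ^ (2 * a)) volume 0 T :=
      intervalIntegral.intervalIntegrable_rpow' (by linarith)
    simpa using (hrpow.comp_sub_left T).symm
  rw [intervalIntegrable_iff_integrableOn_Ioc_of_le hT] at hint
  refine hint.congr_fun (fun t ht ↦ ?_) measurableSet_Ioc
  rw [← Real.rpow_two, ← Real.rpow_mul (sub_nonneg.2 ht.2), mul_comm]

namespace LinearRegulator

variable {X U : Type*} [NormedAddCommGroup X] [NormedSpace ℝ X]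
  [NormedAddCommGroup U] [InnerProductSpace ℝ U]

/-- The kernel `(T-t)^(α-1) T̂_α(T-t) B` through which the control acts on the final state of the
mild solution. -/
def inputKernel (P : LinearRegulator X U) (t : ℝ) : U →L[ℝ] X :=
  (P.T - t) ^ (P.α - 1) • (P.hatOp (P.T - t)).comp P.B

theorem inputKernel_apply (P : LinearRegulator X U) (t : ℝ) (v : U) :
    P.inputKernel t v = (P.T - t) ^ (P.α - 1) • P.hatOp (P.T - t) (P.B v) :=
  rfl

theorem continuousOn_inputKernel (P : LinearRegulator X U) :
    ContinuousOn P.inputKernel (Iio P.T) := by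
  have hsub : ContinuousOn (fun t ↦ P.T - t) (Iio P.T) := by fun_prop
  have hhat : ContinuousOn (fun t ↦ P.hatOp (P.T - t)) (Iio P.T) :=
    P.continuousOn_hatOp.comp hsub fun _ ht ↦ sub_pos.2 (mem_Iio.1 ht)
  exact (hsub.rpow_const fun t ht ↦ .inl (sub_pos.2 ht).ne').smul (hhat.clm_comp continuousOn_const)

theorem memLp_inputKernel (P : LinearRegulator X U) :
    MemLp P.inputKernel 2 (volume.restrict (Ioc 0 P.T)) := by
  obtain ⟨C, hC⟩ := P.exists_norm_hatOp_le
  have hmeas : AEStronglyMeasurable P.inputKernel (volume.restrict (Ioc 0 P.T)) := by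
    rw [← restrict_Ioo_eq_restrict_Ioc]
    exact (P.continuousOn_inputKernel.mono Ioo_subset_Iio_self).aestronglyMeasurable
      measurableSet_Ioo
  have hpow : MemLp (fun t ↦ (P.T - t) ^ (P.α - 1)) 2 (volume.restrict (Ioc 0 P.T)) :=
    memLp_two_rpow_sub P.T_pos.le (by linarith [P.half_lt_α])
  refine hpow.of_le_mul (c := C * ‖P.B‖) hmeas (Eventually.of_forall fun t ↦ ?_)
  rw [inputKernel, norm_smul, mul_comm]
  gcongr
  exact ((P.hatOp _).opNorm_comp_le P.B).trans (by gcongr; exact hC _)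

section InputOp

variable [CompleteSpace X]

/-- The input-to-final-state operator `u ↦ ∫₀ᵀ (T-t)^(α-1) T̂_α(T-t) B u(t) dt`. -/
def inputOp (P : LinearRegulator X U) : Lp U 2 (volume.restrict (Ioc 0 P.T)) →L[ℝ] X :=
  kernelOp P.memLp_inputKernel

theorem cost_eq_tikhonov (P : LinearRegulator X U) {x : ℝ → X} {u : ℝ → U}
    (hx : P.IsMildSolution x u) (hu : MemLp u 2 (volume.restrict (Ioc 0 P.T))) :
    P.cost x u = tikhonov P.inputOp P.lam (P.xT - P.solOp P.T P.ζ) (hu.toLp u) := by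
  have hfinal : x P.T = P.solOp P.T P.ζ + P.inputOp (hu.toLp u) := by
    rw [hx P.T ⟨P.T_pos.le, le_rfl⟩, intervalIntegral.integral_of_le P.T_pos.le, inputOp,
      kernelOp_apply _ hu.coeFn_toLp]
    simp only [inputKernel_apply]
  rw [cost, tikhonov, norm_toLp_two_sq, intervalIntegral.integral_of_le P.T_pos.le, hfinal,
    sub_sub, norm_sub_rev]

theorem isMinOn_tikhonov_of_isOptimalPair (P : LinearRegulator X U) {x : ℝ → X} {u : ℝ → U}
    (h : P.IsOptimalPair x u) (hu : MemLp u 2 (volume.restrict (Ioc 0 P.T))) :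
    IsMinOn (tikhonov P.inputOp P.lam (P.xT - P.solOp P.T P.ζ)) univ (hu.toLp u) := by
  intro v _
  have hv : MemLp v 2 (volume.restrict (Icc 0 P.T)) := by
    rw [← restrict_Ioc_eq_restrict_Icc]
    exact Lp.memLp v
  let y (t : ℝ) : X :=
    P.solOp t P.ζ + ∫ s in (0 : ℝ)..t, (t - s) ^ (P.α - 1) • P.hatOp (t - s) (P.B (v s))
  have hy : P.IsMildSolution y v := fun _ _ ↦ rfl
  have hle := h.2 y v ⟨hv, hy⟩
  rwa [P.cost_eq_tikhonov h.1.2 hu, P.cost_eq_tikhonov hy (Lp.memLp v), Lp.toLp_coeFn] at hle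

end InputOp

variable [CompleteSpace U]

theorem adjointToHilbert_inputKernel (P : LinearRegulator X U) (t : ℝ) (f : StrongDual ℝ X) :
    adjointToHilbert (P.inputKernel t) f = (P.T - t) ^ (P.α - 1) •
      adjointToHilbert P.B (P.hatOpAdjoint (P.T - t) f) := by
  refine (eq_adjointToHilbert fun v ↦ ?_).symm
  rw [real_inner_smul_left, inner_adjointToHilbert, inputKernel_apply, map_smul, hatOpAdjoint,
    ContinuousLinearMap.comp_apply, smul_eq_mul]

theorem feedback_eq_adjointToHilbert (P : LinearRegulator X U) (t : ℝ) :
    P.feedback t = adjointToHilbert (P.inputKernel t)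
      (dualityMap (P.resolvent (P.xT - P.solOp P.T P.ζ))) := by
  rw [adjointToHilbert_inputKernel, feedback]

theorem continuousOn_feedback (P : LinearRegulator X U) :
    ContinuousOn P.feedback (Ico 0 P.T) :=
  ((continuous_adjointToHilbert_left _).comp_continuousOn
    (P.continuousOn_inputKernel.mono Ico_subset_Iio_self)).congr
    fun t _ ↦ P.feedback_eq_adjointToHilbert t

variable [CompleteSpace X]

theorem gramian_eq_inputOp_adjointToHilbert (P : LinearRegulator X U) (f : StrongDual ℝ X) :
    P.gramian f = P.inputOp (adjointToHilbert P.inputOp f) := by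
  rw [gramian, intervalIntegral.integral_of_le P.T_pos.le, inputOp,
    kernelOp_apply _ (adjointToHilbert_kernelOp P.memLp_inputKernel f)]
  refine setIntegral_congr_fun measurableSet_Ioc fun t ht ↦ ?_
  rw [adjointToHilbert_inputKernel, inputKernel_apply, map_smul, map_smul, smul_smul, ← sq,
    ← Real.rpow_two, ← Real.rpow_mul (sub_nonneg.2 ht.2), mul_comm]

theorem shiftedGramian_eq_shiftedNormalMap (P : LinearRegulator X U) :
    P.shiftedGramian = shiftedNormalMap P.inputOp P.lam := by
  funext z
  rw [shiftedGramian, gramian_eq_inputOp_adjointToHilbert, shiftedNormalMap]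

variable [StrictConvexSpace ℝ (StrongDual ℝ X)]

theorem shiftedGramian_bijective (P : LinearRegulator X U) :
    Function.Bijective P.shiftedGramian :=
  P.shiftedGramian_eq_shiftedNormalMap ▸ shiftedNormalMap_bijective P.inputOp P.lam_pos

theorem shiftedGramian_resolvent (P : LinearRegulator X U) (h : X) :
    P.shiftedGramian (P.resolvent h) = h :=
  Function.rightInverse_invFun P.shiftedGramian_bijective.2 h

theorem ae_eq_feedback_of_isOptimalPair (P : LinearRegulator X U) {x : ℝ → X} {u : ℝ → U}
    (h : P.IsOptimalPair x u) : u =ᵐ[volume.restrict (Ico 0 P.T)] P.feedback := by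
  rw [restrict_Ico_eq_restrict_Ioc]
  have hu : MemLp u 2 (volume.restrict (Ioc 0 P.T)) := by
    rw [restrict_Ioc_eq_restrict_Icc]
    exact h.1.1
  set z := P.resolvent (P.xT - P.solOp P.T P.ζ)
  have hnormal : shiftedNormalMap P.inputOp P.lam z = P.xT - P.solOp P.T P.ζ :=
    P.shiftedGramian_eq_shiftedNormalMap ▸ P.shiftedGramian_resolvent _
  have hcontrol : hu.toLp u = adjointToHilbert P.inputOp (dualityMap z) :=
    eq_adjointToHilbert_of_isMinOn P.lam_pos (P.isMinOn_tikhonov_of_isOptimalPair h hu) hnormal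
  calc u =ᵐ[volume.restrict (Ioc 0 P.T)] hu.toLp u := hu.coeFn_toLp.symm
    _ = adjointToHilbert P.inputOp (dualityMap z) := by rw [hcontrol]
    _ =ᵐ[volume.restrict (Ioc 0 P.T)] fun t ↦ adjointToHilbert (P.inputKernel t) (dualityMap z) :=
      adjointToHilbert_kernelOp P.memLp_inputKernel _
    _ = P.feedback := by funext t; rw [feedback_eq_adjointToHilbert]

end LinearRegulator

end FracRegulator

end

theorem lemma3p2_general {X U : Type*}
    [NormedAddCommGroup X] [NormedSpace ℝ X] [CompleteSpace X]
    [StrictConvexSpace ℝ (StrongDual ℝ X)]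
    [NormedAddCommGroup U] [InnerProductSpace ℝ U] [CompleteSpace U]
    (P : FracRegulator.LinearRegulator X U) (x : ℝ → X) (u : ℝ → U)
    (hopt : P.IsOptimalPair x u) :
    Function.Bijective P.shiftedGramian ∧
      ContinuousOn P.feedback (Set.Ico 0 P.T) ∧
      ∀ᵐ t ∂(MeasureTheory.volume.restrict (Set.Ico 0 P.T)), u t = P.feedback t :=
  ⟨P.shiftedGramian_bijective, P.continuousOn_feedback, P.ae_eq_feedback_of_isOptimalPair hopt⟩

theorem lemma3p2 {X U : Type*}
    [NormedAddCommGroup X] [NormedSpace ℝ X] [CompleteSpace X]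
    [TopologicalSpace.SeparableSpace X] [StrictConvexSpace ℝ (StrongDual ℝ X)]
    (hreflexive : Function.Surjective (NormedSpace.inclusionInDoubleDual ℝ X))
    [NormedAddCommGroup U] [InnerProductSpace ℝ U] [CompleteSpace U]
    [TopologicalSpace.SeparableSpace U]
    (P : FracRegulator.LinearRegulator X U) (x : ℝ → X) (u : ℝ → U)
    (hopt : P.IsOptimalPair x u) :
    Function.Bijective P.shiftedGramian ∧
      ContinuousOn P.feedback (Set.Ico 0 P.T) ∧
      ∀ᵐ t ∂(MeasureTheory.volume.restrict (Set.Ico 0 P.T)), u t = P.feedback t :=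
  lemma3p2_general P x u hopt
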